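/- Let $k$ be an algebraically closed field and let $\mathbf{C}$ be a finite length category over $k$: an essentially small $k$-linear abelian category in which every object has finite length and all morphism spaces are finite dimensional. Let $\Lambda$ be a set labelling the isomorphism classes of simple objects $L(\lambda)$, $\lambda\in\Lambda$. For $\Omega\subset\Lambda$ let $\mathbf{C}_\Omega$ be the Serre subcategory of $\mathbf{C}$ generated by the $L(\lambda)$ with $\lambda\in\Omega$. A partial order $\le$ on $\Lambda$ is lower finite if ${\le}\lambda:=\{\mu\mid\mu\le\lambda\}$ is finite for every $\lambda$; an ideal is a union of sets ${\le}\lambda$. For a lower finite partial order $\le$, the pair $(\mathbf{C},\le)$ is a lower finite highest weight (lfhw) category if for each $\lambda\in\Lambda$: (i) $L(\lambda)$ admits an injective hull $\nabla(\lambda)$ (the costandard object) and a projective cover $\Delta(\lambda)$ (the standard object) in $\mathbf{C}_{\le\lambda}$; (ii) $[\nabla(\lambda):L(\lambda)]=1$, and $\nabla(\lambda)$ is injective in $\mathbf{C}_\Omega$ for each finite ideal $\Omega\ni\lambda$ in which $\lambda$ is maximal; (iii) $\mathrm{Ext}^2_{\mathbf{C}}(\Delta(\lambda),\nabla(\mu))=0$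 for each $\mu\in\Lambda$. The essential order $\le^e$ of an lfhw category is the partial order on $\Lambda$ generated by the relations $\mu\le^e\lambda$ whenever $[\Delta(\lambda):L(\mu)]\ne0$ or $[\nabla(\lambda):L(\mu)]\ne0$. Assume that $(\mathbf{C},\le_1)$ and $(\mathbf{C},\le_2)$ are lfhw categories for lower finite partial orders $\le_1$ and $\le_2$ on $\Lambda$, with costandard objects $\nabla_1(\lambda)$ and $\nabla_2(\lambda)$. Then the following are equivalent: 1. the two highest weight structures are equivalent, that is, $\nabla_1(\lambda)\simeq\nabla_2(\lambda)$ for all $\lambda\in\Lambda$; 2. the two essential orders $\le_1^e$ and $\le_2^e$ are the same; 3. $[\nabla_1(\lambda)]=[\nabla_2(\lambda)]$ in the Grothendieck group $K_0(\mathbf{C})$ for all $\lambda\in\Lambda$. -/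

import Mathlib

open CategoryTheory CategoryTheory.Limits

open scoped ZeroObject

universe v u w t

namespace HighestWeight

/-- A finite length category over the field `k`: an essentially small `k`-linear abelian category
in which every object has finite length (is both Noetherian and Artinian) and every morphism
space is finite dimensional. -/
class IsFiniteLengthCategory (k : Type t) [Field k] (C : Type u) [Category.{v} C] [Abelian C]
    [Linear k C] : Prop where
  essentiallySmall : EssentiallySmall.{v} C
  noetherian : ∀ X : C, IsNoetherianObject X
  artinian : ∀ X : C, IsArtinianObject X
  finiteDimensional : ∀ X Y : C, Module.Finite k (X ⟶ Y)

/-- The family `L` labels the isomorphism classes of simple objects by the set `Lam`. -/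
structure IsSimpleLabelling {C : Type u} [Category.{v} C] [Abelian C] {Lam : Type w}
    (L : Lam → C) : Prop where
  simple : ∀ l, Simple (L l)
  existsUnique : ∀ S : C, Simple S → ∃! l, Nonempty (S ≅ L l)

section Multiplicity

variable {C : Type u} [Category.{v} C] [Abelian C]

/-- `HasFactorCount S X n`: there is a composition series `0 = X₀ ⊂ X₁ ⊂ ⋯ ⊂ X_r = X` (with simple
subquotients `X_i / X_{i-1}`), exactly `n` of whose subquotients are isomorphic to `S`.  Each
constructor other than `zero` adds one further step at the top of the series. -/
inductive HasFactorCount (S : C) : C → ℕ → Prop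
  | zero {X : C} (hX : IsZero X) : HasFactorCount S X 0
  | hit {E : ShortComplex C} {n : ℕ} (hE : E.ShortExact) (hs : Simple E.X₃)
      (hiso : Nonempty (E.X₃ ≅ S)) (h : HasFactorCount S E.X₁ n) : HasFactorCount S E.X₂ (n + 1)
  | miss {E : ShortComplex C} {n : ℕ} (hE : E.ShortExact) (hs : Simple E.X₃)
      (hiso : ¬ Nonempty (E.X₃ ≅ S)) (h : HasFactorCount S E.X₁ n) : HasFactorCount S E.X₂ n

/-- The Jordan–Hölder multiplicity `[X : S]` of the simple object `S` in `X`.  For `X` of finite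
length the set below has exactly one element. -/
noncomputable def mult (X S : C) : ℕ := sSup {n | HasFactorCount S X n}

/-- The relations defining the Grothendieck group: `[X₂] - [X₁] - [X₃]` for every short exact
sequence `0 → X₁ → X₂ → X₃ → 0`. -/
def K0Relations (C : Type u) [Category.{v} C] [Abelian C] : Set (FreeAbelianGroup C) :=
  {x | ∃ E : ShortComplex C, E.ShortExact ∧
    x = FreeAbelianGroup.of E.X₂ - FreeAbelianGroup.of E.X₁ - FreeAbelianGroup.of E.X₃}

/-- The Grothendieck group `K₀(C)` of the abelian category `C`. -/
abbrev K0 (C : Type u) [Category.{v} C] [Abelian C] : Type u :=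
  FreeAbelianGroup C ⧸ AddSubgroup.closure (K0Relations C)

/-- The class `[X]` of `X` in `K₀(C)`. -/
def K0.cls (X : C) : K0 C :=
  QuotientAddGroup.mk' (AddSubgroup.closure (K0Relations C)) (FreeAbelianGroup.of X)

end Multiplicity

section Serre

variable {C : Type u} [Category.{v} C] [Abelian C] {Lam : Type w}

/-- The Serre subcategory `C_Ω` of `C` generated by the simple objects `L l`, `l ∈ Ω`: the
intersection of all Serre subcategories containing them. -/
def serreSub (L : Lam → C) (Om : Set Lam) : ObjectProperty C :=
  fun X => ∀ P : ObjectProperty C, P.IsSerreClass → (∀ l ∈ Om, P (L l)) → P X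

/-- `C_{≤ l}`. -/
abbrev serreLE (L : Lam → C) (o : PartialOrder Lam) (l : Lam) : ObjectProperty C :=
  serreSub L {m | o.le m l}

/-- `N` is injective as an object of the full subcategory on `P`. -/
def IsInjectiveIn (P : ObjectProperty C) (N : C) : Prop :=
  ∃ hN : P N, Injective (⟨N, hN⟩ : P.FullSubcategory)

/-- `D` is projective as an object of the full subcategory on `P`. -/
def IsProjectiveIn (P : ObjectProperty C) (D : C) : Prop :=
  ∃ hD : P D, Projective (⟨D, hD⟩ : P.FullSubcategory)

/-- `i : X ⟶ N` is an injective hull of `X` in the Serre subcategory `P`: an essential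
monomorphism into an injective object of `P`. -/
structure IsInjectiveHull (P : ObjectProperty C) {X N : C} (i : X ⟶ N) : Prop where
  injective : IsInjectiveIn P N
  mono : Mono i
  essential : ∀ (Z : C), P Z → ∀ g : N ⟶ Z, Mono (i ≫ g) → Mono g

/-- `p : D ⟶ X` is a projective cover of `X` in the Serre subcategory `P`: an essential
(superfluous) epimorphism from a projective object of `P`. -/
structure IsProjectiveCover (P : ObjectProperty C) {X D : C} (p : D ⟶ X) : Prop where
  projective : IsProjectiveIn P D
  epi : Epi p
  essential : ∀ (Z : C), P Z → ∀ g : Z ⟶ D, Epi (g ≫ p) → Epi g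

/-- `N` is a costandard object `∇(l)`: an injective hull of `L l` in `C_{≤ l}`. -/
def IsCostandard (L : Lam → C) (o : PartialOrder Lam) (l : Lam) (N : C) : Prop :=
  ∃ i : L l ⟶ N, IsInjectiveHull (serreLE L o l) i

/-- `D` is a standard object `Δ(l)`: a projective cover of `L l` in `C_{≤ l}`. -/
def IsStandard (L : Lam → C) (o : PartialOrder Lam) (l : Lam) (D : C) : Prop :=
  ∃ p : D ⟶ L l, IsProjectiveCover (serreLE L o l) p

/-- `Ext^n_C(X, Y) = 0`. -/
def ExtVanishes (X Y : C) (n : ℕ) : Prop :=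
  haveI : HasExt.{max u v} C := HasExt.standard C
  Subsingleton (Abelian.Ext.{max u v} X Y n)

/-- A partial order on `Lam` is lower finite if all sets `{m | m ≤ l}` are finite. -/
def LowerFinite (o : PartialOrder Lam) : Prop :=
  ∀ l, {m | o.le m l}.Finite

/-- `Om` is an ideal: a union of sets of the form `{m | m ≤ l}`, that is, a lower set. -/
def IsIdeal (o : PartialOrder Lam) (Om : Set Lam) : Prop :=
  ∀ l ∈ Om, ∀ m, o.le m l → m ∈ Om

/-- `(C, ≤)` is a lower finite highest weight category, for the partial order `o` on the set
labelling the simple objects `L l`.  Since `∇(l)` and `Δ(l)` are unique up to isomorphism, the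
conditions on them are imposed on every choice. -/
structure IsLfhw (L : Lam → C) (o : PartialOrder Lam) : Prop where
  lowerFinite : LowerFinite o
  exists_costandard : ∀ l, ∃ N, IsCostandard L o l N
  exists_standard : ∀ l, ∃ D, IsStandard L o l D
  mult_costandard : ∀ l N, IsCostandard L o l N → mult N (L l) = 1
  injective_costandard : ∀ l N, IsCostandard L o l N → ∀ Om : Set Lam, Om.Finite →
    IsIdeal o Om → l ∈ Om → (∀ m ∈ Om, o.le l m → m = l) → IsInjectiveIn (serreSub L Om) N
  ext_two : ∀ l m D N, IsStandard L o l D → IsCostandard L o m N → ExtVanishes D N 2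

variable {L : Lam → C} {o : PartialOrder Lam}

/-- The costandard objects `∇(l)`. -/
noncomputable def IsLfhw.costd (h : IsLfhw L o) (l : Lam) : C :=
  (h.exists_costandard l).choose

/-- The standard objects `Δ(l)`. -/
noncomputable def IsLfhw.std (h : IsLfhw L o) (l : Lam) : C :=
  (h.exists_standard l).choose

lemma IsLfhw.isCostandard_costd (h : IsLfhw L o) (l : Lam) : IsCostandard L o l (h.costd l) :=
  (h.exists_costandard l).choose_spec

lemma IsLfhw.isStandard_std (h : IsLfhw L o) (l : Lam) : IsStandard L o l (h.std l) :=
  (h.exists_standard l).choose_spec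

/-- The generating relations of the essential order: `m` is below `l` if `[Δ(l) : L(m)] ≠ 0` or
`[∇(l) : L(m)] ≠ 0`. -/
def IsLfhw.essentialRel (h : IsLfhw L o) (m l : Lam) : Prop :=
  mult (h.std l) (L m) ≠ 0 ∨ mult (h.costd l) (L m) ≠ 0

/-- A Serre subcategory contains every composition factor of each of its objects. -/
lemma prop_of_mult_ne_zero {X S : C} (h : mult X S ≠ 0) (P : ObjectProperty C)
    [P.IsSerreClass] (hX : P X) : P S := by
  have key : ∀ (Y : C) (n : ℕ), HasFactorCount S Y n → n ≠ 0 → P Y → P S := by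
    intro Y n hn
    induction hn with
    | zero _ => intro h0; exact absurd rfl h0
    | hit hE _ hiso _ _ =>
      intro _ hP
      obtain ⟨e⟩ := hiso
      exact P.prop_of_iso e (P.prop_X₃_of_shortExact hE hP)
    | miss hE _ _ _ ih =>
      intro h0 hP
      exact ih h0 (P.prop_X₁_of_shortExact hE hP)
  by_contra hS
  apply h
  have : ∀ n ∈ {n | HasFactorCount S X n}, n = 0 := fun n hn => by
    by_contra h0
    exact hS (key X n hn h0 hX)
  rcases Set.eq_empty_or_nonempty {n | HasFactorCount S X n} with h0 | hne
  · simp [mult, h0]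
  · have : {n | HasFactorCount S X n} = {0} := by
      ext n
      constructor
      · exact this n
      · rintro rfl
        obtain ⟨n, hn⟩ := hne
        exact this n hn ▸ hn
    simp [mult, this]

/-- The Serre subcategory of the objects without nonzero simple subquotient isomorphic to `S`. -/
def avoids (S : C) : ObjectProperty C :=
  fun X => ∀ (Y : C) (i : Y ⟶ X) (q : Y ⟶ S), Mono i → ¬ Epi q

lemma avoids_isSerreClass (S : C) [Simple S] : (avoids S).IsSerreClass where
  exists_zero := ⟨0, isZero_zero C, fun Y i q hi hq => by
    have : IsZero Y := IsZero.of_mono i (isZero_zero C)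
    exact Simple.not_isZero S (IsZero.of_epi q this)⟩
  prop_of_mono f _ hY := fun Z i q hi hq => hY Z (i ≫ f) q (mono_comp _ _) hq
  prop_of_epi {X Y} f _ hX := fun Z i q hi hq =>
    hX (pullback f i) (pullback.fst f i) (pullback.snd f i ≫ q) inferInstance (epi_comp _ _)
  prop_X₂_of_shortExact {E} hE h₁ h₃ := fun Z i q hi hq => by
    have := hE.mono_f
    have := hE.epi_g
    by_cases h0 : pullback.fst i E.f ≫ q = 0
    · -- the quotient of `Z` by its intersection with the subobject still maps onto `S`
      have hk : kernel.ι (i ≫ E.g) ≫ q = 0 := by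
        have hl : (kernel.ι (i ≫ E.g) ≫ i) ≫ E.g = 0 := by simp
        have := pullback.lift_fst (f := i) (g := E.f) (kernel.ι (i ≫ E.g))
          (hE.exact.lift _ hl) (by simp)
        rw [← this, Category.assoc, h0, comp_zero]
      let j := Abelian.factorThruImage (i ≫ E.g)
      have hj : kernel.ι j ≫ q = 0 := by
        have h1 : kernel.ι j ≫ (i ≫ E.g) = 0 := by
          have hfac : j ≫ Abelian.image.ι (i ≫ E.g) = i ≫ E.g := Abelian.image.fac _
          have := kernel.condition_assoc j (Abelian.image.ι (i ≫ E.g))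
          rwa [hfac, zero_comp] at this
        rw [← kernel.lift_ι (i ≫ E.g) (kernel.ι j) h1, Category.assoc, hk, comp_zero]
      have hq' : Epi (Abelian.epiDesc j q hj) := by
        have : Epi (j ≫ Abelian.epiDesc j q hj) := by
          rw [Abelian.comp_epiDesc]; exact hq
        exact epi_of_epi j _
      exact h₃ _ (Abelian.image.ι (i ≫ E.g)) _ inferInstance hq'
    · exact h₁ _ (pullback.snd i E.f) _ inferInstance (epi_of_nonzero_to_simple h0)

lemma mem_of_serreSub (hL : IsSimpleLabelling L) {Om : Set Lam} {m : Lam}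
    (h : serreSub L Om (L m)) : m ∈ Om := by
  by_contra hm
  have := hL.simple m
  refine h (avoids (L m)) (avoids_isSerreClass _) (fun l hl Y i q hi hq => ?_) (L m) (𝟙 _) (𝟙 _)
    inferInstance inferInstance
  have := hL.simple l
  have hi0 : i ≠ 0 := fun h0 => by
    have : IsZero Y := (IsZero.iff_id_eq_zero Y).2 ((cancel_mono i).1 (by simp [h0]))
    exact Simple.not_isZero (L m) (IsZero.of_epi q this)
  have := isIso_of_mono_of_nonzero hi0
  have hq0 : inv i ≫ q ≠ 0 := fun h0 => by
    have : Epi (inv i ≫ q) := epi_comp _ _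
    exact Simple.not_isZero (L m) (IsZero.of_epi_eq_zero _ h0)
  have := isIso_of_hom_simple hq0
  obtain ⟨x, _, hx⟩ := hL.existsUnique (L m) (hL.simple m)
  have h1 := hx l ⟨(asIso (inv i ≫ q)).symm⟩
  have h2 := hx m ⟨Iso.refl _⟩
  exact hm (h2.trans h1.symm ▸ hl)

lemma serreSub_isSerreClass (L : Lam → C) (Om : Set Lam) : (serreSub L Om).IsSerreClass where
  exists_zero := ⟨0, isZero_zero C, fun P _ _ => P.prop_zero⟩
  prop_of_mono f _ hY := fun P hP hl => P.prop_of_mono f (hY P hP hl)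
  prop_of_epi f _ hX := fun P hP hl => P.prop_of_epi f (hX P hP hl)
  prop_X₂_of_shortExact hE h₁ h₃ := fun P hP hl =>
    P.prop_X₂_of_shortExact hE (h₁ P hP hl) (h₃ P hP hl)

lemma IsLfhw.le_of_essentialRel (h : IsLfhw L o) (hL : IsSimpleLabelling L) {m l : Lam}
    (hr : h.essentialRel m l) : o.le m l := by
  have := serreSub_isSerreClass L {m | o.le m l}
  refine mem_of_serreSub (Om := {m | o.le m l}) hL ?_
  rcases hr with hr | hr
  · obtain ⟨p, hp⟩ := h.isStandard_std l
    exact prop_of_mult_ne_zero hr _ hp.projective.1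
  · obtain ⟨i, hi⟩ := h.isCostandard_costd l
    exact prop_of_mult_ne_zero hr _ hi.injective.1

/-- The essential order `≤ᵉ`: the partial order generated by `essentialRel`, that is, its
reflexive and transitive closure. -/
@[reducible]
def IsLfhw.essentialOrder (h : IsLfhw L o) (hL : IsSimpleLabelling L) : PartialOrder Lam where
  le := Relation.ReflTransGen h.essentialRel
  lt a b := Relation.ReflTransGen h.essentialRel a b ∧ ¬ Relation.ReflTransGen h.essentialRel b a
  lt_iff_le_not_ge _ _ := Iff.rfl
  le_refl _ := Relation.ReflTransGen.refl
  le_trans _ _ _ := Relation.ReflTransGen.trans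
  le_antisymm a b hab hba := by
    have key : ∀ {x y}, Relation.ReflTransGen h.essentialRel x y → o.le x y := by
      intro x y hxy
      induction hxy with
      | refl => exact o.le_refl _
      | tail _ h2 ih => exact o.le_trans _ _ _ ih (h.le_of_essentialRel hL h2)
    exact o.le_antisymm _ _ (key hab) (key hba)

/-- Two highest weight structures on `C` are equivalent if their costandard objects are
isomorphic. -/
def Equivalent {o₁ o₂ : PartialOrder Lam} (h₁ : IsLfhw L o₁) (h₂ : IsLfhw L o₂) : Prop :=
  ∀ l, Nonempty (h₁.costd l ≅ h₂.costd l)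

end Serre

end HighestWeight

namespace HighestWeight

/-! ### Jordan–Hölder theory and classes in `K0` -/

section JordanHolder

variable {C : Type u} [Category.{v} C] [Abelian C]

/-! Membership in `serreSub L Om` is detected by composition factors, and injective hulls of one
simple object in two Serre subcategories are isomorphic once each hull lies in both
(`IsInjectiveHull.nonempty_iso`). Hence the two structures are equivalent as soon as the factors of
∇₁(l) have labels ≤₂ l and those of ∇₂(l) have labels ≤₁ l (`equivalent_of_mult`). Equal classes in
`K0` give this because multiplicity is additive on short exact sequences; equal essential orders
give it because each essential order is contained in the order that defines it.

The substantial implication is from isomorphic costandard objects to equal essential orders, since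
these also involve standard objects. If m' is a ≤₁-maximal label among the factors of Δ₂(l), then
∇₁(m') is injective on a finite ideal supporting Δ₂(l), which produces a nonzero map Δ₂(l) ⟶ ∇₁(m')
≅ ∇₂(m'). Such a map forces l = m' (`eq_of_hom_ne_zero`), so Δ₂(l) lies in the first C_{≤ l}
(`serreLE_of_equivalent`). By symmetry and uniqueness of projective covers, Δ₁(l) ≅ Δ₂(l).

Since `mult` is a supremum over composition series, all this rests on the Jordan–Hölder theorem,
obtained from `HasFactorCount.exists_add`. -/

lemma HasFactorCount.of_iso {S X Y : C} {n : ℕ} (h : HasFactorCount S X n) (e : X ≅ Y) :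
    HasFactorCount S Y n := by
  cases h with
  | zero hX => exact .zero (hX.of_iso e.symm)
  | @hit E n hE hs hi h =>
    have w : (E.f ≫ e.hom) ≫ e.inv ≫ E.g = 0 := by simp
    refine .hit (E := .mk (E.f ≫ e.hom) (e.inv ≫ E.g) w) ?_ hs hi h
    exact ShortComplex.shortExact_of_iso
      (ShortComplex.isoMk (S₁ := E) (Iso.refl _) e (Iso.refl _) (by simp) (by simp)) hE
  | @miss E n hE hs hi h =>
    have w : (E.f ≫ e.hom) ≫ e.inv ≫ E.g = 0 := by simp
    refine .miss (E := .mk (E.f ≫ e.hom) (e.inv ≫ E.g) w) ?_ hs hi h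
    exact ShortComplex.shortExact_of_iso
      (ShortComplex.isoMk (S₁ := E) (Iso.refl _) e (Iso.refl _) (by simp) (by simp)) hE

open Classical in
/-- The multiplicity of `S` in a simple object `T`. -/
noncomputable def simpleMult (T S : C) : ℕ := if Nonempty (T ≅ S) then 1 else 0

lemma HasFactorCount.step {S : C} {E : ShortComplex C} {n : ℕ} (hE : E.ShortExact)
    (hs : Simple E.X₃) (h : HasFactorCount S E.X₁ n) :
    HasFactorCount S E.X₂ (n + simpleMult E.X₃ S) := by
  by_cases hi : Nonempty (E.X₃ ≅ S)
  · simpa [simpleMult, hi] using HasFactorCount.hit hE hs hi h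
  · simpa [simpleMult, hi] using HasFactorCount.miss hE hs hi h

/-- Inversion that treats `hit` and `miss` uniformly, with `simpleMult` recording the contribution
of the top factor. -/
lemma HasFactorCount.cases_step {S X : C} {n : ℕ} (h : HasFactorCount S X n) :
    (IsZero X ∧ n = 0) ∨ ∃ (M T : C) (m : M ⟶ X) (p : X ⟶ T) (w : m ≫ p = 0) (a : ℕ),
      (ShortComplex.mk m p w).ShortExact ∧ Simple T ∧ HasFactorCount S M a ∧
        n = a + simpleMult T S := by
  cases h with
  | zero hX => exact .inl ⟨hX, rfl⟩
  | @hit E n hE hs hi h =>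
    exact .inr ⟨_, _, E.f, E.g, E.zero, n, hE, hs, h, by simp [simpleMult, hi]⟩
  | @miss E n hE hs hi h =>
    exact .inr ⟨_, _, E.f, E.g, E.zero, n, hE, hs, h, by simp [simpleMult, hi]⟩

lemma HasFactorCount.eq_zero_of_isZero {S X : C} {n : ℕ} (h : HasFactorCount S X n)
    (hX : IsZero X) : n = 0 := by
  obtain ⟨_, h⟩ | ⟨M, T, m, p, w, a, hE, hs, -, -⟩ := h.cases_step
  · exact h
  · have : Epi p := hE.epi_g
    exact absurd (IsZero.of_epi p hX) (Simple.not_isZero T)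

lemma HasFactorCount.eq_simpleMult {S X : C} [Simple X] {n : ℕ} (h : HasFactorCount S X n) :
    n = simpleMult X S := by
  obtain ⟨hX, _⟩ | ⟨M, T, m, p, w, a, hE, hs, hM, rfl⟩ := h.cases_step
  · exact absurd hX (Simple.not_isZero X)
  · have : Epi p := hE.epi_g
    have : Mono m := hE.mono_f
    have hp : p ≠ 0 := fun h0 => Simple.not_isZero T (IsZero.of_epi_eq_zero p h0)
    have := isIso_of_hom_simple hp
    have hm : m = 0 := by rw [← cancel_mono p, w, zero_comp]
    have ha : a = 0 := hM.eq_zero_of_isZero (IsZero.of_mono_eq_zero m hm)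
    have : Nonempty (T ≅ S) ↔ Nonempty (X ≅ S) :=
      ⟨fun ⟨e⟩ => ⟨asIso p ≪≫ e⟩, fun ⟨e⟩ => ⟨(asIso p).symm ≪≫ e⟩⟩
    rw [ha, zero_add]
    by_cases hS : Nonempty (X ≅ S)
    · rw [simpleMult, simpleMult, if_pos hS, if_pos (this.2 hS)]
    · rw [simpleMult, simpleMult, if_neg hS, if_neg (mt this.1 hS)]

/-- A composition series of the middle term whose top step has quotient `T`: if the subobject `K`
lies in the kernel `M` of the quotient map to `T`, then `M` is an extension by `K` of the kernel of
the induced map on the quotient `Q`. -/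
lemma shortExact_of_comp_eq_zero {K X Q M T : C} {f : K ⟶ X} {g : X ⟶ Q} {w : f ≫ g = 0}
    (hE : (ShortComplex.mk f g w).ShortExact) {m : M ⟶ X} {p : X ⟶ T} {w' : m ≫ p = 0}
    (hE' : (ShortComplex.mk m p w').ShortExact) (h0 : f ≫ p = 0) :
    ∃ (Q' : C) (f' : K ⟶ M) (q : M ⟶ Q') (w₁ : f' ≫ q = 0) (i : Q' ⟶ Q) (r : Q ⟶ T)
      (w₂ : i ≫ r = 0), (ShortComplex.mk f' q w₁).ShortExact ∧
        (ShortComplex.mk i r w₂).ShortExact := by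
  have : Mono f := hE.mono_f
  have : Epi g := hE.epi_g
  have : Mono m := hE'.mono_f
  have : Epi p := hE'.epi_g
  obtain ⟨r, hr⟩ : ∃ r, g ≫ r = p := ⟨_, hE.exact.g_desc p h0⟩
  obtain ⟨f', hf'⟩ : ∃ f', f' ≫ m = f := ⟨_, hE'.exact.lift_f f h0⟩
  have hmgr : (m ≫ g) ≫ r = 0 := by rw [Category.assoc, hr, w']
  obtain ⟨q, hq⟩ : ∃ q, q ≫ kernel.ι r = m ≫ g := ⟨_, kernel.lift_ι r _ hmgr⟩
  have w₁ : f' ≫ q = 0 := by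
    rw [← cancel_mono (kernel.ι r), Category.assoc, hq, ← Category.assoc, hf', w, zero_comp]
  have : Epi r := by
    have : Epi (g ≫ r) := hr ▸ inferInstance
    exact epi_of_epi g r
  refine ⟨kernel r, f', q, w₁, kernel.ι r, r, kernel.condition r, ?_,
    .mk' (ShortComplex.exact_kernel r) inferInstance inferInstance⟩
  refine .mk' ?_ ?_ ?_
  · rw [ShortComplex.exact_iff_exact_up_to_refinements]
    intro A x hx
    dsimp at x hx
    have hx' : (x ≫ m) ≫ g = 0 := by rw [Category.assoc, ← hq, reassoc_of% hx, zero_comp]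
    obtain ⟨y, hy⟩ : ∃ y, y ≫ f = x ≫ m := ⟨_, hE.exact.lift_f _ hx'⟩
    refine ⟨A, 𝟙 A, inferInstance, y, ?_⟩
    dsimp
    rw [← cancel_mono m, Category.id_comp, Category.assoc, hf', hy]
  · have : Mono (f' ≫ m) := hf' ▸ inferInstance
    exact mono_of_mono f' m
  · dsimp
    rw [epi_iff_surjective_up_to_refinements]
    intro A y
    obtain ⟨A', π, hπ, z, hz⟩ := surjective_up_to_refinements_of_epi g (y ≫ kernel.ι r)
    have hzp : z ≫ p = 0 := by
      rw [← hr, ← reassoc_of% hz, kernel.condition, comp_zero, comp_zero]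
    obtain ⟨x, hx⟩ : ∃ x, x ≫ m = z := ⟨_, hE'.exact.lift_f z hzp⟩
    refine ⟨A', π, hπ, x, ?_⟩
    rw [← cancel_mono (kernel.ι r), Category.assoc, Category.assoc, hq, hz, ← hx, Category.assoc]

/-- If the subobject `K` maps onto the quotient `T` with kernel `M`, then `M` is an extension of
the same quotient `Q` by the kernel of `K ⟶ T`. -/
lemma shortExact_of_comp_epi {K X Q M T : C} {f : K ⟶ X} {g : X ⟶ Q} {w : f ≫ g = 0}
    (hE : (ShortComplex.mk f g w).ShortExact) {m : M ⟶ X} {p : X ⟶ T} {w' : m ≫ p = 0}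
    (hE' : (ShortComplex.mk m p w').ShortExact) [Epi (f ≫ p)] :
    ∃ (f' : kernel (f ≫ p) ⟶ M) (q : M ⟶ Q) (w₁ : f' ≫ q = 0),
      (ShortComplex.mk f' q w₁).ShortExact := by
  have : Mono f := hE.mono_f
  have : Epi g := hE.epi_g
  have : Mono m := hE'.mono_f
  have : Epi p := hE'.epi_g
  obtain ⟨f', hf'⟩ : ∃ f', f' ≫ m = kernel.ι (f ≫ p) ≫ f :=
    ⟨_, hE'.exact.lift_f (kernel.ι (f ≫ p) ≫ f) (by simp)⟩
  refine ⟨f', m ≫ g, by rw [reassoc_of% hf', w, comp_zero], .mk' ?_ ?_ ?_⟩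
  · rw [ShortComplex.exact_iff_exact_up_to_refinements]
    intro A x hx
    dsimp at x hx
    obtain ⟨y, hy⟩ : ∃ y, y ≫ f = x ≫ m := ⟨_, hE.exact.lift_f (x ≫ m) (by simpa using hx)⟩
    have hy' : y ≫ f ≫ p = 0 := by rw [reassoc_of% hy, w', comp_zero]
    refine ⟨A, 𝟙 A, inferInstance, kernel.lift _ y hy', ?_⟩
    dsimp
    rw [← cancel_mono m, Category.id_comp, Category.assoc, hf', kernel.lift_ι_assoc, hy]
  · have : Mono (f' ≫ m) := hf' ▸ inferInstance
    exact mono_of_mono f' m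
  -- If `h` kills the image of `M`, then `g ≫ h` descends along `p` to `r`; this `r` vanishes after
  -- the epimorphism `f ≫ p` because `f ≫ g = 0`.
  · refine Preadditive.epi_of_cancel_zero _ fun {Z} h hh => ?_
    dsimp at h hh
    obtain ⟨r, hr⟩ : ∃ r, p ≫ r = g ≫ h := ⟨_, hE'.exact.g_desc (g ≫ h) (by simpa using hh)⟩
    have hr0 : r = 0 := by
      rw [← cancel_epi (f ≫ p), Category.assoc, hr, reassoc_of% w, zero_comp, comp_zero]
    rw [← cancel_epi g, ← hr, hr0, comp_zero, comp_zero]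

/-- Any composition series of the middle term induces series on the subobject and the quotient, with
no factor lost. Working with an arbitrary given series is what yields uniqueness of the count
afterwards. -/
lemma HasFactorCount.exists_add {S X : C} {n : ℕ} (h : HasFactorCount S X n) :
    ∀ {K Q : C} {f : K ⟶ X} {g : X ⟶ Q} {w : f ≫ g = 0},
      (ShortComplex.mk f g w).ShortExact →
      ∃ a b, HasFactorCount S K a ∧ HasFactorCount S Q b ∧ n = a + b := by
  have key : ∀ {E : ShortComplex C} {n : ℕ}, E.ShortExact → Simple E.X₃ →
      (∀ {K Q : C} {f : K ⟶ E.X₁} {g : E.X₁ ⟶ Q} {w : f ≫ g = 0},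
        (ShortComplex.mk f g w).ShortExact →
        ∃ a b, HasFactorCount S K a ∧ HasFactorCount S Q b ∧ n = a + b) →
      ∀ {K Q : C} {f : K ⟶ E.X₂} {g : E.X₂ ⟶ Q} {w : f ≫ g = 0},
        (ShortComplex.mk f g w).ShortExact →
        ∃ a b, HasFactorCount S K a ∧ HasFactorCount S Q b ∧
          n + simpleMult E.X₃ S = a + b := by
    intro E n hE' hs ih K Q f g w hE
    -- As the top factor is simple, `K` either maps to zero in it, and the factor belongs to `Q`, or
    -- maps onto it, and the factor belongs to `K`.
    by_cases h0 : f ≫ E.g = 0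
    · obtain ⟨Q', f', q, w₁, i, r, w₂, h₁, h₂⟩ := shortExact_of_comp_eq_zero hE hE' h0
      obtain ⟨a, b, ha, hb, rfl⟩ := ih h₁
      exact ⟨a, _, ha, hb.step h₂ hs, add_assoc _ _ _⟩
    · have : Epi (f ≫ E.g) := epi_of_nonzero_to_simple h0
      obtain ⟨f', q, w₁, h₁⟩ := shortExact_of_comp_epi hE hE'
      obtain ⟨a, b, ha, hb, rfl⟩ := ih h₁
      exact ⟨_, b, ha.step (E := .mk _ _ (kernel.condition (f ≫ E.g)))
        (.mk' (ShortComplex.exact_kernel _) inferInstance this) hs, hb, add_right_comm _ _ _⟩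
  induction h with
  | zero hX =>
    intro K Q f g w hE
    have : Mono f := hE.mono_f
    have : Epi g := hE.epi_g
    exact ⟨0, 0, .zero (IsZero.of_mono f hX), .zero (IsZero.of_epi g hX), rfl⟩
  | hit hE hs hi _ ih =>
    intro K Q f g w hE'
    simpa [simpleMult, hi] using key hE hs ih hE'
  | miss hE hs hi _ ih =>
    intro K Q f g w hE'
    simpa [simpleMult, hi] using key hE hs ih hE'

lemma HasFactorCount.unique {S X : C} {n m : ℕ} (hn : HasFactorCount S X n)
    (hm : HasFactorCount S X m) : n = m := by
  induction hn generalizing m with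
  | zero hX => exact (hm.eq_zero_of_isZero hX).symm
  | hit hE hs hi _ ih =>
    obtain ⟨a, b, ha, hb, rfl⟩ := hm.exists_add hE
    rw [ih ha, hb.eq_simpleMult, simpleMult, if_pos hi]
  | miss hE hs hi _ ih =>
    obtain ⟨a, b, ha, hb, rfl⟩ := hm.exists_add hE
    rw [ih ha, hb.eq_simpleMult, simpleMult, if_neg hi, add_zero]

/-- Induction on objects of finite length, by extensions with a simple quotient. -/
lemma finiteLength_induction {P : C → Prop} (X : C) [IsNoetherianObject X]
    (hart : ∀ Y : C, IsArtinianObject Y) (zero : ∀ Y, IsZero Y → P Y)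
    (iso : ∀ Y Z : C, (Y ≅ Z) → P Y → P Z)
    (step : ∀ E : ShortComplex C, E.ShortExact → Simple E.X₃ → P E.X₁ → P E.X₂) : P X := by
  -- Take a maximal subobject satisfying `P`. Were it proper, the preimage of a simple subobject of
  -- the cokernel would be a strictly larger one.
  obtain ⟨Y, hY, hmax⟩ := (wellFounded_gt (α := Subobject X)).has_min
    {Y | P (Y : C)} ⟨⊥, zero _ ((isZero_zero C).of_iso Subobject.botCoeIsoZero)⟩
  by_cases hcok : IsZero (cokernel Y.arrow)
  · have : Epi Y.arrow := Abelian.epi_of_cokernel_π_eq_zero _ (hcok.eq_of_tgt _ _)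
    have := isIso_of_mono_of_epi Y.arrow
    exact iso _ _ (asIso Y.arrow) hY
  · exfalso
    have := hart (cokernel Y.arrow)
    let t := simpleSubobjectArrow hcok
    let c := cokernel.π Y.arrow
    let j : (Y : C) ⟶ pullback c t := pullback.lift Y.arrow 0 (by simp [c])
    have hj : j ≫ pullback.fst c t = Y.arrow := pullback.lift_fst _ _ _
    have hj0 : j ≫ pullback.snd c t = 0 := pullback.lift_snd _ _ _
    have hS : (ShortComplex.mk j (pullback.snd c t) hj0).ShortExact := by
      refine .mk' ?_ ?_ (inferInstanceAs (Epi (pullback.snd c t)))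
      · rw [ShortComplex.exact_iff_exact_up_to_refinements]
        intro A x hx
        dsimp at x hx
        have hx' : (x ≫ pullback.fst c t) ≫ c = 0 := by
          rw [Category.assoc, pullback.condition, reassoc_of% hx, zero_comp]
        obtain ⟨y, hy⟩ : ∃ y, y ≫ Y.arrow = x ≫ pullback.fst c t :=
          ⟨_, (ShortComplex.exact_cokernel Y.arrow).lift_f _ hx'⟩
        refine ⟨A, 𝟙 A, inferInstance, y, ?_⟩
        dsimp
        rw [Category.id_comp]
        apply pullback.hom_ext
        · rw [Category.assoc, hj, hy]
        · rw [Category.assoc, hj0, hx, comp_zero]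
      · have : Mono (j ≫ pullback.fst c t) := by rw [hj]; infer_instance
        exact mono_of_mono j (pullback.fst c t)
    have hs : Simple (simpleSubobject hcok) := inferInstance
    refine hmax (Subobject.mk (pullback.fst c t))
      (iso _ _ (Subobject.underlyingIso _).symm (step _ hS hs hY)) ?_
    refine lt_of_le_of_ne (Subobject.le_mk_of_comm j hj) fun heq => ?_
    have hle : Subobject.mk (pullback.fst c t) ≤ Y := heq.ge
    have hfst : pullback.fst c t ≫ c = 0 := by
      rw [← Subobject.ofMkLE_arrow hle, Category.assoc, cokernel.condition, comp_zero]
    have hsnd : pullback.snd c t = 0 := by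
      rw [← cancel_mono t, ← pullback.condition, hfst, zero_comp]
    exact Simple.not_isZero _ (IsZero.of_epi_eq_zero (pullback.snd c t) hsnd)

lemma exists_hasFactorCount (hnoe : ∀ Y : C, IsNoetherianObject Y)
    (hart : ∀ Y : C, IsArtinianObject Y) (S X : C) : ∃ n, HasFactorCount S X n :=
  have := hnoe X
  finiteLength_induction (P := fun X => ∃ n, HasFactorCount S X n) X hart
    (fun _ hY => ⟨0, .zero hY⟩) (fun _ _ e ⟨n, h⟩ => ⟨n, h.of_iso e⟩)
    fun _ hE hs ⟨_, h⟩ => ⟨_, h.step hE hs⟩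

lemma HasFactorCount.mult_eq {S X : C} {n : ℕ} (h : HasFactorCount S X n) : mult X S = n := by
  have : {n | HasFactorCount S X n} = {n} :=
    Set.eq_singleton_iff_unique_mem.2 ⟨h, fun m hm => HasFactorCount.unique hm h⟩
  rw [mult, this, csSup_singleton]

lemma mult_of_simple {S X : C} [Simple X] : mult X S = simpleMult X S := by
  have h := HasFactorCount.step (S := S) (E := .mk (0 : (0 : C) ⟶ X) (𝟙 X) zero_comp)
    (.mk' ((ShortComplex.exact_iff_mono _ rfl).2 inferInstance) inferInstance
      (inferInstanceAs (Epi (𝟙 X)))) ‹Simple X› (.zero (isZero_zero C))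
  simpa using h.mult_eq

lemma mult_congr {X Y : C} (e : X ≅ Y) (S : C) : mult X S = mult Y S := by
  have : {n | HasFactorCount S X n} = {n | HasFactorCount S Y n} :=
    Set.ext fun n => ⟨fun h => HasFactorCount.of_iso h e, fun h => HasFactorCount.of_iso h e.symm⟩
  rw [mult, mult, this]

lemma mult_add (hnoe : ∀ Y : C, IsNoetherianObject Y) (hart : ∀ Y : C, IsArtinianObject Y)
    {E : ShortComplex C} (hE : E.ShortExact) (S : C) :
    mult E.X₂ S = mult E.X₁ S + mult E.X₃ S := by
  obtain ⟨n, hn⟩ := exists_hasFactorCount hnoe hart S E.X₂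
  obtain ⟨a, b, ha, hb, hab⟩ := hn.exists_add hE
  rw [hn.mult_eq, ha.mult_eq, hb.mult_eq, hab]

/-- Multiplicities only depend on classes in the Grothendieck group. -/
lemma mult_eq_of_cls_eq (hnoe : ∀ Y : C, IsNoetherianObject Y)
    (hart : ∀ Y : C, IsArtinianObject Y) {X Y : C} (h : K0.cls X = K0.cls Y) (S : C) :
    mult X S = mult Y S := by
  let φ : FreeAbelianGroup C →+ ℤ := FreeAbelianGroup.lift fun Z => (mult Z S : ℤ)
  have hφ : AddSubgroup.closure (K0Relations C) ≤ φ.ker := by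
    rw [AddSubgroup.closure_le]
    rintro _ ⟨E, hE, rfl⟩
    simp [φ, AddMonoidHom.mem_ker, mult_add hnoe hart hE S]
  have := congrArg (QuotientAddGroup.lift _ φ hφ) h
  simpa [K0.cls, φ] using this

/-- The sequence X ≅ Y ⟶ 0 gives the relation up to the class of the zero object, which a second
sequence shows to be zero. -/
lemma cls_eq_of_iso {X Y : C} (e : X ≅ Y) : K0.cls X = K0.cls Y := by
  have hE : (ShortComplex.mk e.hom (0 : Y ⟶ 0) comp_zero).ShortExact :=
    .mk' ((ShortComplex.exact_iff_epi _ rfl).2 (inferInstanceAs (Epi e.hom)))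
      (inferInstanceAs (Mono e.hom)) (inferInstanceAs (Epi (0 : Y ⟶ 0)))
  have h0 : (ShortComplex.mk (𝟙 (0 : C)) (0 : (0 : C) ⟶ 0) comp_zero).ShortExact :=
    .mk' ((ShortComplex.exact_iff_epi _ rfl).2 (inferInstanceAs (Epi (𝟙 (0 : C)))))
      (inferInstanceAs (Mono (𝟙 (0 : C)))) (inferInstanceAs (Epi (0 : (0 : C) ⟶ 0)))
  have h : ∀ {E : ShortComplex C}, E.ShortExact → K0.cls E.X₂ - K0.cls E.X₁ - K0.cls E.X₃ = 0 :=
    fun {E} hE => (QuotientAddGroup.eq_zero_iff _).2 (AddSubgroup.subset_closure ⟨E, hE, rfl⟩)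
  have h₁ := h hE
  have h₂ := h h0
  dsimp at h₁ h₂
  rw [sub_self, zero_sub, neg_eq_zero] at h₂
  rw [h₂, sub_zero, sub_eq_zero] at h₁
  exact h₁.symm

end JordanHolder

/-! ### Injective hulls and projective covers in full subcategories -/

section FullSubcategory

variable {C : Type u} [Category.{v} C]

lemma IsInjectiveIn.exists_extension {P : ObjectProperty C} {N : C} (h : IsInjectiveIn P N)
    {X Y : C} (hX : P X) (hY : P Y) (f : X ⟶ Y) [Mono f] (g : X ⟶ N) : ∃ r : Y ⟶ N, f ≫ r = g := by
  obtain ⟨hN, hinj⟩ := h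
  let f' : (⟨X, hX⟩ : P.FullSubcategory) ⟶ ⟨Y, hY⟩ := ObjectProperty.homMk f
  let g' : (⟨X, hX⟩ : P.FullSubcategory) ⟶ ⟨N, hN⟩ := ObjectProperty.homMk g
  have : Mono f' := P.ι.mono_of_mono_map (inferInstanceAs (Mono f))
  obtain ⟨r, hr⟩ := hinj.factors g' f'
  exact ⟨r.hom, congrArg (fun a => a.hom) hr⟩

lemma IsProjectiveIn.exists_lift {P : ObjectProperty C} {D : C} (h : IsProjectiveIn P D)
    {X Y : C} (hX : P X) (hY : P Y) (f : X ⟶ Y) [Epi f] (g : D ⟶ Y) : ∃ r : D ⟶ X, r ≫ f = g := by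
  obtain ⟨hD, hproj⟩ := h
  let f' : (⟨X, hX⟩ : P.FullSubcategory) ⟶ ⟨Y, hY⟩ := ObjectProperty.homMk f
  let g' : (⟨D, hD⟩ : P.FullSubcategory) ⟶ ⟨Y, hY⟩ := ObjectProperty.homMk g
  have : Epi f' := P.ι.epi_of_epi_map (inferInstanceAs (Epi f))
  obtain ⟨r, hr⟩ := hproj.factors g' f'
  exact ⟨r.hom, congrArg (fun a => a.hom) hr⟩

/-- Injective hulls of the same object in two subcategories are isomorphic as soon as each lies in
both subcategories. -/
lemma IsInjectiveHull.nonempty_iso {P₁ P₂ : ObjectProperty C} {X N₁ N₂ : C} {i₁ : X ⟶ N₁}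
    {i₂ : X ⟶ N₂} (h₁ : IsInjectiveHull P₁ i₁) (h₂ : IsInjectiveHull P₂ i₂) (hX : P₂ X)
    (hN₁ : P₂ N₁) (hN₂ : P₁ N₂) : Nonempty (N₁ ≅ N₂) := by
  have := h₁.mono
  have := h₂.mono
  obtain ⟨g, hg⟩ := h₂.injective.exists_extension hX hN₁ i₁ i₂
  have : Mono g := h₁.essential _ hN₂ g (hg ▸ h₂.mono)
  obtain ⟨r, hr⟩ := h₁.injective.exists_extension h₁.injective.1 hN₂ g (𝟙 N₁)
  have hr' : i₂ ≫ r = i₁ := by rw [← hg, Category.assoc, hr, Category.comp_id]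
  -- The retraction `r` of `g` is a split epimorphism; essentiality of `i₂` makes it a monomorphism
  -- too, hence an isomorphism.
  have : Mono r := h₂.essential _ hN₁ r (hr' ▸ h₁.mono)
  exact ⟨⟨g, r, hr, by rw [← cancel_mono r, Category.assoc, hr, Category.comp_id,
    Category.id_comp]⟩⟩

/-- Projective covers of the same object in two subcategories are isomorphic as soon as each lies
in both subcategories. -/
lemma IsProjectiveCover.nonempty_iso {P₁ P₂ : ObjectProperty C} {X D₁ D₂ : C} {p₁ : D₁ ⟶ X}
    {p₂ : D₂ ⟶ X} (h₁ : IsProjectiveCover P₁ p₁) (h₂ : IsProjectiveCover P₂ p₂) (hX : P₂ X)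
    (hD₁ : P₂ D₁) (hD₂ : P₁ D₂) : Nonempty (D₁ ≅ D₂) := by
  have := h₁.epi
  have := h₂.epi
  obtain ⟨g, hg⟩ := h₂.projective.exists_lift hD₁ hX p₁ p₂
  have : Epi g := h₁.essential _ hD₂ g (hg ▸ h₂.epi)
  obtain ⟨r, hr⟩ := h₁.projective.exists_lift hD₂ h₁.projective.1 g (𝟙 D₁)
  have hr' : r ≫ p₂ = p₁ := by rw [← hg, ← Category.assoc, hr, Category.id_comp]
  have : Epi r := h₂.essential _ hD₁ r (hr' ▸ h₁.epi)
  exact ⟨⟨r, g, hr, by rw [← cancel_epi r, ← Category.assoc, hr, Category.comp_id,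
    Category.id_comp]⟩⟩

end FullSubcategory

/-! ### Supports, standard objects and comparison of structures -/

section Serre

variable {C : Type u} [Category.{v} C] [Abelian C] {Lam : Type w} {L : Lam → C}

lemma serreSub_of_mult (hnoe : ∀ Y : C, IsNoetherianObject Y)
    (hart : ∀ Y : C, IsArtinianObject Y) (hL : IsSimpleLabelling L) {Om : Set Lam} (X : C)
    (hX : ∀ m, mult X (L m) ≠ 0 → m ∈ Om) : serreSub L Om X := by
  have := serreSub_isSerreClass L Om
  have := hnoe X
  refine finiteLength_induction (P := fun X => (∀ m, mult X (L m) ≠ 0 → m ∈ Om) → serreSub L Om X)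
    X hart (fun Y hY _ => (serreSub L Om).prop_of_isZero hY)
    (fun Y Z e hY hZ => (serreSub L Om).prop_of_iso e
      (hY fun m hm => hZ m (by rwa [← mult_congr e]))) (fun E hE hs ih hm => ?_) hX
  refine (serreSub L Om).prop_X₂_of_shortExact hE
    (ih fun m h => hm m (by rw [mult_add hnoe hart hE]; lia)) ?_
  obtain ⟨l, ⟨e⟩, -⟩ := hL.existsUnique _ hs
  refine (serreSub L Om).prop_of_iso e.symm fun P _ hP => hP l (hm l ?_)
  have : mult E.X₃ (L l) = 1 := by rw [mult_of_simple, simpleMult, if_pos ⟨e⟩]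
  rw [mult_add hnoe hart hE]
  lia

lemma finite_setOf_mult_ne_zero (hnoe : ∀ Y : C, IsNoetherianObject Y)
    (hart : ∀ Y : C, IsArtinianObject Y) (hL : IsSimpleLabelling L) (X : C) :
    {m | mult X (L m) ≠ 0}.Finite := by
  have := hnoe X
  refine finiteLength_induction (P := fun X => {m | mult X (L m) ≠ 0}.Finite)
    X hart (fun Y hY => ?_) (fun Y Z e hY => by simpa only [mult_congr e] using hY)
    (fun E hE hs ih => ?_)
  · simp [(HasFactorCount.zero hY).mult_eq]
  · obtain ⟨l, -, hl⟩ := hL.existsUnique _ hs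
    refine (ih.union (Set.finite_singleton l)).subset fun m hm => ?_
    rw [Set.mem_ofPred_eq, mult_add hnoe hart hE, mult_of_simple (X := E.X₃)] at hm
    by_cases h : Nonempty (E.X₃ ≅ L m)
    · exact .inr (hl m h)
    · rw [simpleMult, if_neg h, add_zero] at hm
      exact .inl hm

/-- Objects without such a subquotient form the Serre subcategory `avoids S`, which does not contain
`S`. -/
lemma exists_sub_epi_of_mult_ne_zero {X S : C} [Simple S] (h : mult X S ≠ 0) :
    ∃ (Y : C) (i : Y ⟶ X) (q : Y ⟶ S), Mono i ∧ Epi q := by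
  by_contra! hX
  have := avoids_isSerreClass S
  exact prop_of_mult_ne_zero h (avoids S) hX S (𝟙 S) (𝟙 S) inferInstance inferInstance

variable {o o₁ o₂ : PartialOrder Lam}

lemma serreSub_self {Om : Set Lam} {l : Lam} (hl : l ∈ Om) : serreSub L Om (L l) :=
  fun _ _ hP => hP l hl

/-- A nonzero morphism from a standard to a costandard object relates equal labels. -/
lemma eq_of_hom_ne_zero (hL : IsSimpleLabelling L) {l m : Lam} {D N : C}
    (hD : IsStandard L o l D) (hN : IsCostandard L o m N) {f : D ⟶ N} (hf : f ≠ 0) : l = m := by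
  obtain ⟨p, hp⟩ := hD
  obtain ⟨i, hi⟩ := hN
  have hCl := serreSub_isSerreClass L {a | o.le a l}
  have hCm := serreSub_isSerreClass L {a | o.le a m}
  have := hL.simple l
  have := hL.simple m
  have := hp.epi
  have := hi.mono
  refine o.le_antisymm _ _ (mem_of_serreSub (Om := {a | o.le a m}) hL ?_)
    (mem_of_serreSub (Om := {a | o.le a l}) hL ?_)
  -- Since `p` is superfluous and `f ≠ 0`, `p` kills the kernel of `f`. Thus `L l` is a quotient of
  -- the image of `f`, a subobject of `N`, and so l ≤ m. The other bullet is dual.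
  · have hk : kernel.ι f ≫ p = 0 := by
      by_contra h0
      have : Epi (kernel.ι f) := hp.essential _
        ((serreLE L o l).prop_of_mono (kernel.ι f) hp.projective.1) _ (epi_of_nonzero_to_simple h0)
      exact hf (by rw [← cancel_epi (kernel.ι f), kernel.condition, comp_zero])
    let e := Abelian.factorThruImage f
    have he : kernel.ι e ≫ p = 0 := by
      have h1 : kernel.ι e ≫ f = 0 := by
        have h2 := kernel.condition_assoc e (Abelian.image.ι f)
        rwa [Abelian.image.fac f, zero_comp] at h2
      rw [← kernel.lift_ι f (kernel.ι e) h1, Category.assoc, hk, comp_zero]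
    have : Epi (Abelian.epiDesc e p he) := by
      have : Epi (e ≫ Abelian.epiDesc e p he) := by rw [Abelian.comp_epiDesc]; infer_instance
      exact epi_of_epi e _
    exact (serreLE L o m).prop_of_epi (Abelian.epiDesc e p he)
      ((serreLE L o m).prop_of_mono (Abelian.image.ι f) hi.injective.1)
  · have hk : i ≫ cokernel.π f = 0 := by
      by_contra h0
      have : Mono (cokernel.π f) := hi.essential _
        ((serreLE L o m).prop_of_epi (cokernel.π f) hi.injective.1) _
        (mono_of_nonzero_from_simple h0)
      exact hf (by rw [← cancel_mono (cokernel.π f), cokernel.condition, zero_comp])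
    let j : L m ⟶ Abelian.image f := kernel.lift _ i hk
    have hj : j ≫ Abelian.image.ι f = i := kernel.lift_ι _ _ _
    have : Mono j := by
      have : Mono (j ≫ Abelian.image.ι f) := hj ▸ inferInstance
      exact mono_of_mono j (Abelian.image.ι f)
    exact (serreLE L o l).prop_of_mono j
      ((serreLE L o l).prop_of_epi (Abelian.factorThruImage f) hp.projective.1)

/-- If the costandard objects of two structures agree, the standard objects of the second structure
satisfy the support condition of the first one. -/
lemma serreLE_of_equivalent (hnoe : ∀ Y : C, IsNoetherianObject Y)
    (hart : ∀ Y : C, IsArtinianObject Y) (hL : IsSimpleLabelling L) (h₁ : IsLfhw L o₁)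
    (h₂ : IsLfhw L o₂) (h : Equivalent h₁ h₂) {l : Lam} {D : C} (hD : IsStandard L o₂ l D) :
    serreLE L o₁ l D := by
  refine serreSub_of_mult hnoe hart hL D fun m hm => ?_
  have hfin := finite_setOf_mult_ne_zero hnoe hart hL D
  -- A maximal factor label above `m` exists because `D` has finitely many factors; the aim is to
  -- show m' = l.
  obtain ⟨m', hmm', hm'⟩ := (letI := o₁; hfin.exists_le_maximal hm)
  -- The ideal generated by the factors of `D`: it is finite by lower finiteness, and `m'` stays
  -- maximal in it, so the injectivity axiom applies to ∇₁(m').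
  let Om : Set Lam := ⋃ a ∈ {a | mult D (L a) ≠ 0}, {b | o₁.le b a}
  have hmem : ∀ a, mult D (L a) ≠ 0 → a ∈ Om := fun a ha => Set.mem_biUnion ha (o₁.le_refl a)
  have hOm : Om.Finite := hfin.biUnion fun a _ => h₁.lowerFinite a
  have hideal : IsIdeal o₁ Om := by
    intro a ha b hb
    obtain ⟨c, hc, hac⟩ := Set.mem_iUnion₂.1 ha
    exact Set.mem_biUnion hc (o₁.le_trans _ _ _ hb hac)
  have hmax : ∀ a ∈ Om, o₁.le m' a → a = m' := by
    intro a ha hma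
    obtain ⟨c, hc, hac⟩ := Set.mem_iUnion₂.1 ha
    exact o₁.le_antisymm _ _ (o₁.le_trans _ _ _ hac (hm'.2 hc (o₁.le_trans _ _ _ hma hac))) hma
  have hinj := h₁.injective_costandard m' _ (h₁.isCostandard_costd m') Om hOm hideal
    (hmem m' hm'.1) hmax
  have hDOm : serreSub L Om D := serreSub_of_mult hnoe hart hL D hmem
  have := serreSub_isSerreClass L Om
  have := hL.simple m'
  obtain ⟨Y, j, q, hj, hq⟩ := exists_sub_epi_of_mult_ne_zero hm'.1
  obtain ⟨i, hi⟩ := h₁.isCostandard_costd m'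
  have := hi.mono
  -- The subquotient Y ⟶ L(m') ⟶ ∇₁(m') extends to all of `D`; the extension is nonzero because `q ≫
  -- i` is.
  obtain ⟨r, hr⟩ := hinj.exists_extension ((serreSub L Om).prop_of_mono j hDOm) hDOm j (q ≫ i)
  obtain ⟨e⟩ := h m'
  have hre : r ≫ e.hom ≠ 0 := fun h0 => by
    have hr0 : r = 0 := by rw [← cancel_mono e.hom, h0, zero_comp]
    rw [hr0, comp_zero] at hr
    have hq0 : q = 0 := by rw [← cancel_mono i, ← hr, zero_comp]
    exact Simple.not_isZero (L m') (IsZero.of_epi_eq_zero q hq0)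
  rw [eq_of_hom_ne_zero hL hD (h₂.isCostandard_costd m') hre]
  exact hmm'

lemma Equivalent.symm {h₁ : IsLfhw L o₁} {h₂ : IsLfhw L o₂} (h : Equivalent h₁ h₂) :
    Equivalent h₂ h₁ :=
  fun l => (h l).map Iso.symm

/-- Equivalent highest weight structures have isomorphic standard objects. -/
lemma Equivalent.nonempty_std_iso (hnoe : ∀ Y : C, IsNoetherianObject Y)
    (hart : ∀ Y : C, IsArtinianObject Y) (hL : IsSimpleLabelling L) {h₁ : IsLfhw L o₁}
    {h₂ : IsLfhw L o₂} (h : Equivalent h₁ h₂) (l : Lam) : Nonempty (h₁.std l ≅ h₂.std l) := by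
  obtain ⟨p₁, hp₁⟩ := h₁.isStandard_std l
  obtain ⟨p₂, hp₂⟩ := h₂.isStandard_std l
  exact hp₁.nonempty_iso hp₂ (serreSub_self (o₂.le_refl l))
    (serreLE_of_equivalent hnoe hart hL h₂ h₁ h.symm (h₁.isStandard_std l))
    (serreLE_of_equivalent hnoe hart hL h₁ h₂ h (h₂.isStandard_std l))

/-- Two highest weight structures are equivalent if the composition factors of the costandard
objects of each are bounded by their labels in the order of the other. -/
lemma equivalent_of_mult (hnoe : ∀ Y : C, IsNoetherianObject Y)
    (hart : ∀ Y : C, IsArtinianObject Y) (hL : IsSimpleLabelling L) {h₁ : IsLfhw L o₁}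
    {h₂ : IsLfhw L o₂} (h₁₂ : ∀ l m, mult (h₁.costd l) (L m) ≠ 0 → o₂.le m l)
    (h₂₁ : ∀ l m, mult (h₂.costd l) (L m) ≠ 0 → o₁.le m l) : Equivalent h₁ h₂ := by
  intro l
  obtain ⟨i₁, hi₁⟩ := h₁.isCostandard_costd l
  obtain ⟨i₂, hi₂⟩ := h₂.isCostandard_costd l
  exact hi₁.nonempty_iso hi₂ (serreSub_self (o₂.le_refl l))
    (serreSub_of_mult hnoe hart hL _ (h₁₂ l)) (serreSub_of_mult hnoe hart hL _ (h₂₁ l))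

lemma IsLfhw.le_of_essentialOrder_le (h : IsLfhw L o) (hL : IsSimpleLabelling L) {m l : Lam}
    (hml : (h.essentialOrder hL).le m l) : o.le m l := by
  have key : Relation.ReflTransGen h.essentialRel m l := hml
  clear hml
  induction key with
  | refl => exact o.le_refl _
  | tail _ hr ih => exact o.le_trans _ _ _ ih (h.le_of_essentialRel hL hr)

lemma IsLfhw.essentialOrder_le_of_mult_costd (h : IsLfhw L o) (hL : IsSimpleLabelling L)
    {m l : Lam} (hm : mult (h.costd l) (L m) ≠ 0) : (h.essentialOrder hL).le m l :=
  Relation.ReflTransGen.single (.inr hm)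

end Serre

end HighestWeight

theorem mainTheorem8 {k : Type t} [Field k] [IsAlgClosed k]
    {C : Type u} [Category.{v} C] [Abelian C] [Linear k C]
    [HighestWeight.IsFiniteLengthCategory k C]
    {Lam : Type w} (L : Lam → C) (hL : HighestWeight.IsSimpleLabelling L)
    (o₁ o₂ : PartialOrder Lam)
    (h₁ : HighestWeight.IsLfhw L o₁) (h₂ : HighestWeight.IsLfhw L o₂) :
    List.TFAE
      [HighestWeight.Equivalent h₁ h₂,
        h₁.essentialOrder hL = h₂.essentialOrder hL,
        ∀ l : Lam, HighestWeight.K0.cls (h₁.costd l) = HighestWeight.K0.cls (h₂.costd l)] := by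
  have hnoe := HighestWeight.IsFiniteLengthCategory.noetherian (k := k) (C := C)
  have hart := HighestWeight.IsFiniteLengthCategory.artinian (k := k) (C := C)
  tfae_have 1 → 2 := fun h => by
    have hrel : h₁.essentialRel = h₂.essentialRel := by
      funext m l
      obtain ⟨e⟩ := h l
      obtain ⟨e'⟩ := h.nonempty_std_iso hnoe hart hL l
      simp only [HighestWeight.IsLfhw.essentialRel, HighestWeight.mult_congr e,
        HighestWeight.mult_congr e']
    refine PartialOrder.ext fun a b => ?_
    change Relation.ReflTransGen _ a b ↔ Relation.ReflTransGen _ a b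
    rw [hrel]
  -- A factor of ∇₁(l) has label below l in the first essential order, hence in the second, hence
  -- for ≤₂; and symmetrically.
  tfae_have 2 → 1 := fun h =>
    HighestWeight.equivalent_of_mult hnoe hart hL
      (fun l m hm => h₂.le_of_essentialOrder_le hL (h ▸ h₁.essentialOrder_le_of_mult_costd hL hm))
      (fun l m hm => h₁.le_of_essentialOrder_le hL (h ▸ h₂.essentialOrder_le_of_mult_costd hL hm))
  tfae_have 1 → 3 := fun h l => (h l).elim HighestWeight.cls_eq_of_iso
  tfae_have 3 → 1 := fun h =>
    have hmult := fun l m => HighestWeight.mult_eq_of_cls_eq hnoe hart (h l) (L m)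
    HighestWeight.equivalent_of_mult hnoe hart hL
      (fun l m hm => h₂.le_of_essentialRel hL (.inr (by rwa [← hmult])))
      (fun l m hm => h₁.le_of_essentialRel hL (.inr (by rwa [hmult])))
  tfae_finish
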